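/- Let $\mathcal K$ be a finitely complete (strict) 2-category, i.e. one with all finite conical 2-limits and all cotensors with the walking arrow $\mathbb 2$. A span $A\xleftarrow{q}E\xrightarrow{p}B$ of categories and functors is a two-sided discrete fibration if: (i) each arrow $qe\to a'$ of $A$ has a unique lift in $E$ with domain $e$ lying over $1_{pe}$; (ii) each arrow $b'\to pe$ of $B$ has a unique lift in $E$ with codomain $e$ lying over $1_{qe}$; (iii) for each $u\colon e\to e'$ in $E$, the codomain of the lift of $qu$ in (i) with domain $e$ equals the domain of the lift of $pu$ in (ii) with codomain $e'$, and the composite of these lifts is $u$. A span $A\xleftarrow{q}E\xrightarrow{p}B$ in $\mathcal K$ is a two-sided discrete fibration if the span of categories $\mathcal K(X,A)\xleftarrow{\mathcal K(X,q)}\mathcal K(X,E)\xrightarrow{\mathcal K(X,p)}\mathcal K(X,B)$ is one for every $X\in\mathcal K$. A map of spans from $A$ to $B$ is a 1-cell between the apices that commutes strictly with both legs. **Theorem (Yoneda lemma).** Let $A\xleftarrow{q}E\xrightarrow{p}B$ be a two-sided discrete fibration in $\mathcal K$ and let $f\colon A\to B$ be a 1-cell. Then the comma object $A\xleftarrow{c}B/f\xrightarrow{d}B$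 of $B\xrightarrow{1_B}B\xleftarrow{f}A$, with universal 2-cell $\theta\colon d\Rightarrow fc$, exists. For any choice of it there is a unique 1-cell $i\colon A\to B/f$ with $ci=1_A$, $di=f$ and $\theta i=\mathrm{id}_f$, and precomposition with $i$ is a bijection from the set of maps of spans $(A\xleftarrow{c}B/f\xrightarrow{d}B)\to(A\xleftarrow{q}E\xrightarrow{p}B)$ to the set of maps of spans $(A\xleftarrow{1_A}A\xrightarrow{f}B)\to(A\xleftarrow{q}E\xrightarrow{p}B)$. -/

import Mathlib

open CategoryTheory Bicategory Limits

universe w v u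

namespace TwoCat

/-! A (strict) 2-category is a `Bicategory` which is `Bicategory.Strict`; identity 2-cells between
1-cells that are equal but not syntactically so are written `eqToHom`. Composition of 1-cells is
in diagrammatic order: `f ≫ g` is `f` followed by `g`. -/

section FunctorsBetweenCategories

universe vA uA vE uE vB uB

/-- A span of functors `A ←q- E -p→ B` is a two-sided discrete fibration (from `A` to `B`). -/
structure IsTwoSidedDiscreteFibration {A : Type uA} [Category.{vA} A] {E : Type uE}
    [Category.{vE} E] {B : Type uB} [Category.{vB} B] (q : E ⥤ A) (p : E ⥤ B) : Prop where
  /-- Each `g : q e ⟶ a'` has a unique lift with domain `e` in the fibre over `p e`. -/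
  existsUnique_opcartesian_lift : ∀ (e : E) {a' : A} (g : q.obj e ⟶ a'),
    ∃! x : Σ e' : E, (e ⟶ e'), q.IsHomLift g x.2 ∧ p.IsHomLift (𝟙 (p.obj e)) x.2
  /-- Each `g : b' ⟶ p e` has a unique lift with codomain `e` in the fibre over `q e`. -/
  existsUnique_cartesian_lift : ∀ (e : E) {b' : B} (g : b' ⟶ p.obj e),
    ∃! x : Σ e' : E, (e' ⟶ e), p.IsHomLift g x.2 ∧ q.IsHomLift (𝟙 (q.obj e)) x.2
  /-- For each `f : e ⟶ e'`, the lift `χ` of `q f` with domain `e` and the lift `ζ` of `p f` with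
  codomain `e'` are composable, with composite `f`. -/
  factorization : ∀ {e e' : E} (f : e ⟶ e') (m m' : E) (χ : e ⟶ m) (ζ : m' ⟶ e'),
    q.IsHomLift (q.map f) χ → p.IsHomLift (𝟙 (p.obj e)) χ →
    p.IsHomLift (p.map f) ζ → q.IsHomLift (𝟙 (q.obj e')) ζ →
    ∃ h : m = m', χ ≫ eqToHom h ≫ ζ = f

end FunctorsBetweenCategories

variable {K : Type u} [Bicategory.{w, v} K]

/-- For a 2-cell `θ : d ⟶ c` between 1-cells `P ⟶ A`, the functor `K(X, P) ⥤ K(X, A)^𝟚` which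
whiskers `θ`. -/
@[simps]
def arrowComparison {A P : K} {d c : P ⟶ A} (θ : d ⟶ c) (X : K) : (X ⟶ P) ⥤ Arrow (X ⟶ A) where
  obj h := Arrow.mk (h ◁ θ)
  map α := Arrow.homMk (α ▷ d) (α ▷ c) (whisker_exchange α θ).symm

/-- `θ : d ⟶ c : P ⟶ A` exhibits `P` as the cotensor of `A` with the walking arrow `𝟚`:
whiskering `θ` gives isomorphisms of categories `K(X, P) ≅ K(X, A)^𝟚`. -/
def IsArrowCotensor {A P : K} {d c : P ⟶ A} (θ : d ⟶ c) : Prop :=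
  ∀ X : K, (arrowComparison θ X).IsIso

/-- For a square `d ≫ f ⟶ c ≫ g` over the opspan `B -f→ C ←g- A`, the functor from `K(X, P)` to
the comma category of `K(X, f)` and `K(X, g)`. -/
@[simps]
def commaComparison {A B C P : K} {f : B ⟶ C} {g : A ⟶ C} {d : P ⟶ B} {c : P ⟶ A}
    (θ : d ≫ f ⟶ c ≫ g) (X : K) : (X ⟶ P) ⥤ Comma (postcomp X f) (postcomp X g) where
  obj h :=
    { left := h ≫ d
      right := h ≫ c
      hom := (α_ h d f).hom ≫ h ◁ θ ≫ (α_ h c g).inv }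
  map α :=
    { left := α ▷ d
      right := α ▷ c
      w := by
        have e : α ▷ d ▷ f ≫ (α_ _ d f).hom ≫ _ ◁ θ ≫ (α_ _ c g).inv =
            ((α_ _ d f).hom ≫ _ ◁ θ ≫ (α_ _ c g).inv) ≫ α ▷ c ▷ g := by
          rw [associator_naturality_left_assoc, ← whisker_exchange_assoc]
          simp
        exact e }

/-- `θ : d ≫ f ⟶ c ≫ g` exhibits `P` as the comma object `f/g` of `B -f→ C ←g- A`: it induces
isomorphisms from `K(X, P)` to the comma category `K(X, f)/K(X, g)`. -/
def IsCommaObject {A B C P : K} {f : B ⟶ C} {g : A ⟶ C} {d : P ⟶ B} {c : P ⟶ A}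
    (θ : d ≫ f ⟶ c ≫ g) : Prop :=
  ∀ X : K, (commaComparison θ X).IsIso

variable [Bicategory.Strict K]

/-- The cone `t` over `F` is a conical 2-limit: for every `X`, composition with `t` is an
isomorphism from `K(X, t.pt)` to the category of cones over `F` with vertex `X`, whose morphisms
are the compatible families of 2-cells. The two fields say that this functor is bijective on
objects and on morphisms, respectively. -/
structure IsConicalTwoLimit {J : Type} [SmallCategory J] {F : J ⥤ K} (t : Cone F) : Prop where
  isLimit : Nonempty (IsLimit t)
  existsUnique_twoCell : ∀ {X : K} (f g : X ⟶ t.pt)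
    (α : ∀ j : J, f ≫ t.π.app j ⟶ g ≫ t.π.app j),
    (∀ {j k : J} (s : j ⟶ k),
      α j ▷ F.map s =
        eqToHom (by rw [Category.assoc, t.w]) ≫ α k ≫ eqToHom (by rw [Category.assoc, t.w])) →
    ∃! β : f ⟶ g, ∀ j : J, β ▷ t.π.app j = α j

variable (K) in
/-- A 2-category is finitely complete if it has finite conical 2-limits and cotensors with the
walking arrow. -/
class FinitelyComplete : Prop where
  exists_conicalTwoLimit : ∀ (J : Type) [SmallCategory J] [FinCategory J] (F : J ⥤ K),
    ∃ t : Cone F, IsConicalTwoLimit t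
  exists_arrowCotensor : ∀ A : K, ∃ (P : K) (d c : P ⟶ A) (θ : d ⟶ c), IsArrowCotensor θ

/-- Spans `A ←l- apex -r→ B` in `K`. Their morphisms are the 1-cells between the apices which
commute strictly with both legs. -/
abbrev TwoSpan (A B : K) := Span (⊤ : MorphismProperty K) (⊤ : MorphismProperty K) A B

/-- The span `A ←q- E -p→ B`. -/
@[simps]
def TwoSpan.mk {A B E : K} (q : E ⟶ A) (p : E ⟶ B) : TwoSpan A B where
  apex := E
  l := q
  r := p
  wl := trivial
  wr := trivial

/-- A span in a 2-category is a two-sided discrete fibration if it is so representably. -/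
def TwoSpan.IsTwoSidedDiscreteFibration {A B : K} (S : TwoSpan A B) : Prop :=
  ∀ X : K, TwoCat.IsTwoSidedDiscreteFibration (postcomp X S.l) (postcomp X S.r)

/-- For a 2-cell `θ : d ≫ 𝟙 B ⟶ c ≫ f`, a 1-cell `i : A ⟶ P` is induced by the identity 2-cell of
`f` if `i ≫ c = 𝟙 A`, `i ≫ d = f` and whiskering `θ` with `i` gives the identity 2-cell of `f`. -/
structure InducedByIdentity {A B P : K} {f : A ⟶ B} {d : P ⟶ B} {c : P ⟶ A}
    (θ : d ≫ 𝟙 B ⟶ c ≫ f) (i : A ⟶ P) : Prop where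
  comp_left : i ≫ c = 𝟙 A
  comp_right : i ≫ d = f
  whiskerLeft_eq : i ◁ θ = eqToHom (by
    rw [Category.comp_id, comp_right, ← Category.assoc, comp_left, Category.id_comp])

/-- The map of spans from `A = A -f→ B` to `A ←c- P -d→ B` given by a 1-cell induced by the
identity 2-cell of `f`. -/
def InducedByIdentity.spanHom {A B P : K} {f : A ⟶ B} {d : P ⟶ B} {c : P ⟶ A}
    {θ : d ≫ 𝟙 B ⟶ c ≫ f} {i : A ⟶ P} (hi : InducedByIdentity θ i) :
    TwoSpan.mk (𝟙 A) f ⟶ TwoSpan.mk c d :=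
  Span.Hom.mk i hi.comp_left hi.comp_right

end TwoCat

namespace TwoCat

variable {K : Type u} [Bicategory.{w, v} K]

/-! In diagrammatic order, let `P` be the comma object with projections `d`, `c` and 2-cell `θ`. It
is the pullback along `f` of the codomain projection of the arrow cotensor of `B`, and `i` is the
1-cell that classifies the identity square on `f`.

The Yoneda bijection rests on a 2-cell `η : 𝟙 P ⟶ c ≫ i` with `η ▷ d = θ` and `η ▷ c` an identity
(`IsCommaObject.exists_unit`). Given a span map `k : P ⟶ E` with `i ≫ k = g`, whiskering `η` with
`k` gives a 2-cell `k ⟶ c ≫ g` that lies over `θ` on the right and over an identity on the left. So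
`k` is the domain of the cartesian lift of `θ` with codomain `c ≫ g`, and is determined by `g`.
Conversely, given `g`, the domain `k` of that lift is a span map; restricted along `i` the lift lies
over identities, so uniqueness of lifts gives `i ≫ k = g`.

Strictness equates 1-cells only propositionally. Equations between 2-cells are therefore handled as
heterogeneous equalities, in which the transports disappear. -/

theorem comma_eq_iff {C₁ C₂ C₃ : Type*} [Category* C₁] [Category* C₂] [Category* C₃]
    {L : C₁ ⥤ C₃} {R : C₂ ⥤ C₃} {x y : Comma L R} :
    x = y ↔ ∃ (hl : x.left = y.left) (hr : x.right = y.right),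
      x.hom = eqToHom (by rw [hl]) ≫ y.hom ≫ eqToHom (by rw [hr]) := by
  constructor
  · rintro rfl
    exact ⟨rfl, rfl, by simp⟩
  · obtain ⟨xl, xr, xh⟩ := x
    obtain ⟨yl, yr, yh⟩ := y
    rintro ⟨hl, hr, h⟩
    dsimp at hl hr
    subst hl hr
    simp at h
    rw [h]

/-- The equation saying that two 2-cells `φ : x ⟶ y` and `ψ : x' ⟶ y'` agree, for equal 1-cells. -/
theorem heq_iff_eqToHom {C₁ : Type*} [Category* C₁] {x y x' y' : C₁} (φ : x ⟶ y) (ψ : x' ⟶ y')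
    (hx : x = x') (hy : y = y') : φ ≍ ψ ↔ φ = eqToHom hx ≫ ψ ≫ eqToHom hy.symm := by
  subst hx hy
  simp

variable [Bicategory.Strict K]

/-! ### Strict coherence as heterogeneous equalities -/

theorem associator_hom_eq {a b c d : K} (f : a ⟶ b) (g : b ⟶ c) (h : c ⟶ d) :
    (α_ f g h).hom = eqToHom (Strict.assoc f g h) := by
  rw [Strict.associator_eqToIso]; rfl

theorem associator_inv_eq {a b c d : K} (f : a ⟶ b) (g : b ⟶ c) (h : c ⟶ d) :
    (α_ f g h).inv = eqToHom (Strict.assoc f g h).symm := by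
  rw [Strict.associator_eqToIso]; rfl

theorem leftUnitor_hom_eq {a b : K} (f : a ⟶ b) :
    (λ_ f).hom = eqToHom (Strict.id_comp f) := by
  rw [Strict.leftUnitor_eqToIso]; rfl

theorem leftUnitor_inv_eq {a b : K} (f : a ⟶ b) :
    (λ_ f).inv = eqToHom (Strict.id_comp f).symm := by
  rw [Strict.leftUnitor_eqToIso]; rfl

theorem rightUnitor_hom_eq {a b : K} (f : a ⟶ b) :
    (ρ_ f).hom = eqToHom (Strict.comp_id f) := by
  rw [Strict.rightUnitor_eqToIso]; rfl

theorem rightUnitor_inv_eq {a b : K} (f : a ⟶ b) :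
    (ρ_ f).inv = eqToHom (Strict.comp_id f).symm := by
  rw [Strict.rightUnitor_eqToIso]; rfl

theorem whiskerLeft_comp_heq {a b c d : K} (f : a ⟶ b) (g : b ⟶ c) {h h' : c ⟶ d}
    (η : h ⟶ h') : (f ≫ g) ◁ η ≍ f ◁ g ◁ η := by
  rw [heq_iff_eqToHom _ _ (Strict.assoc ..) (Strict.assoc ..), comp_whiskerLeft,
    associator_hom_eq, associator_inv_eq]

theorem whiskerRight_comp_heq {a b c d : K} {f f' : a ⟶ b} (η : f ⟶ f') (g : b ⟶ c) (h : c ⟶ d) :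
    η ▷ (g ≫ h) ≍ η ▷ g ▷ h := by
  rw [heq_iff_eqToHom _ _ (Strict.assoc ..).symm (Strict.assoc ..).symm, whiskerRight_comp,
    associator_hom_eq, associator_inv_eq]

theorem whisker_assoc_heq {a b c d : K} (f : a ⟶ b) {g g' : b ⟶ c} (η : g ⟶ g') (h : c ⟶ d) :
    (f ◁ η) ▷ h ≍ f ◁ η ▷ h := by
  rw [heq_iff_eqToHom _ _ (Strict.assoc ..) (Strict.assoc ..), whisker_assoc,
    associator_hom_eq, associator_inv_eq]

theorem id_whiskerLeft_heq {a b : K} {f f' : a ⟶ b} (η : f ⟶ f') : 𝟙 a ◁ η ≍ η := by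
  rw [heq_iff_eqToHom _ _ (Strict.id_comp ..) (Strict.id_comp ..), id_whiskerLeft,
    leftUnitor_hom_eq, leftUnitor_inv_eq]

theorem whiskerRight_id_heq {a b : K} {f f' : a ⟶ b} (η : f ⟶ f') : η ▷ 𝟙 b ≍ η := by
  rw [heq_iff_eqToHom _ _ (Strict.comp_id ..) (Strict.comp_id ..), whiskerRight_id,
    rightUnitor_hom_eq, rightUnitor_inv_eq]

theorem whiskerRight_heq {a b c : K} {f f' g g' : a ⟶ b} {η : f ⟶ f'} {ζ : g ⟶ g'}
    (hf : f = g) (hf' : f' = g') (h : η ≍ ζ) {k k' : b ⟶ c} (hk : k = k') : η ▷ k ≍ ζ ▷ k' := by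
  subst hf hf' h hk; rfl

theorem whiskerLeft_heq {a b c : K} {f f' g g' : b ⟶ c} {η : f ⟶ f'} {ζ : g ⟶ g'}
    (hf : f = g) (hf' : f' = g') (h : η ≍ ζ) {k k' : a ⟶ b} (hk : k = k') : k ◁ η ≍ k' ◁ ζ := by
  subst hf hf' h hk; rfl

theorem eqToHom_comp_comp_eqToHom_heq {C₁ : Type*} [Category* C₁] {x y x' y' : C₁} (φ : x ⟶ y)
    (hx : x' = x) (hy : y = y') : eqToHom hx ≫ φ ≫ eqToHom hy ≍ φ := by
  subst hx hy
  simp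

theorem comp_heq_comp {C₁ : Type*} [Category* C₁] {x y z x' y' z' : C₁} {φ : x ⟶ y} {ψ : y ⟶ z}
    {φ' : x' ⟶ y'} {ψ' : y' ⟶ z'} (hx : x = x') (hy : y = y') (hz : z = z')
    (hφ : φ ≍ φ') (hψ : ψ ≍ ψ') : φ ≫ ψ ≍ φ' ≫ ψ' := by
  subst hx hy hz hφ hψ; rfl

theorem isHomLift_iff_heq {𝒳 𝒮 : Type*} [Category* 𝒳] [Category* 𝒮] (p : 𝒳 ⥤ 𝒮) {R S : 𝒮}
    {a b : 𝒳} (f : R ⟶ S) (φ : a ⟶ b) :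
    p.IsHomLift f φ ↔ p.obj a = R ∧ p.obj b = S ∧ p.map φ ≍ f := by
  constructor
  · rintro ⟨⟩
    exact ⟨rfl, rfl, HEq.rfl⟩
  · rintro ⟨rfl, rfl, h⟩
    cases h
    infer_instance

/-! ### Universal properties of comma objects and arrow cotensors -/

section

variable {A B C P : K} {f : B ⟶ C} {g : A ⟶ C} {d : P ⟶ B} {c : P ⟶ A}

theorem commaComparison_obj_hom_heq (θ : d ≫ f ⟶ c ≫ g) {X : K} (h : X ⟶ P) :
    ((commaComparison θ X).obj h).hom ≍ h ◁ θ := by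
  rw [commaComparison_obj_hom, associator_hom_eq, associator_inv_eq]
  exact eqToHom_comp_comp_eqToHom_heq ..

theorem commaComparison_obj_eq_iff (θ : d ≫ f ⟶ c ≫ g) {X : K} (h : X ⟶ P)
    (y : Comma (postcomp X f) (postcomp X g)) :
    (commaComparison θ X).obj h = y ↔ h ≫ d = y.left ∧ h ≫ c = y.right ∧ h ◁ θ ≍ y.hom := by
  rw [comma_eq_iff]
  constructor
  · rintro ⟨h₁, h₂, h₃⟩
    refine ⟨h₁, h₂, (commaComparison_obj_hom_heq θ h).symm.trans ?_⟩
    rw [h₃]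
    simp
  · rintro ⟨h₁, h₂, h₃⟩
    refine ⟨h₁, h₂, (heq_iff_eqToHom _ _ (congrArg (· ≫ f) h₁) (congrArg (· ≫ g) h₂)).1 ?_⟩
    exact (commaComparison_obj_hom_heq θ h).trans h₃

/-- A comma object classifies squares. -/
theorem IsCommaObject.existsUnique_lift {θ : d ≫ f ⟶ c ≫ g} (hθ : IsCommaObject θ) {X : K}
    (x : X ⟶ B) (y : X ⟶ A) (φ : x ≫ f ⟶ y ≫ g) :
    ∃! h : X ⟶ P, h ≫ d = x ∧ h ≫ c = y ∧ h ◁ θ ≍ φ := by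
  have := (hθ X).bijective_obj.existsUnique
    ({ left := x, right := y, hom := φ } : Comma (postcomp X f) (postcomp X g))
  exact (existsUnique_congr fun h => commaComparison_obj_eq_iff θ h _).1 this

/-- The two-dimensional part of the universal property of a comma object. -/
theorem IsCommaObject.exists_twoCell {θ : d ≫ f ⟶ c ≫ g} (hθ : IsCommaObject θ) {X : K}
    (h k : X ⟶ P) (α : h ≫ d ⟶ k ≫ d) (β : h ≫ c ⟶ k ≫ c)
    (w : α ▷ f ≫ (α_ k d f).hom ≫ k ◁ θ ≫ (α_ k c g).inv =
      ((α_ h d f).hom ≫ h ◁ θ ≫ (α_ h c g).inv) ≫ β ▷ g) :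
    ∃ γ : h ⟶ k, γ ▷ d = α ∧ γ ▷ c = β := by
  have := hθ X
  let m : (commaComparison θ X).obj h ⟶ (commaComparison θ X).obj k :=
    { left := α, right := β, w := w }
  obtain ⟨γ, hγ⟩ := (commaComparison θ X).map_surjective m
  exact ⟨γ, congrArg CommaMorphism.left hγ, congrArg CommaMorphism.right hγ⟩

/-- `h₁` is bijectivity of the comparison functor on objects. In `h₂`, existence gives fullness and
uniqueness gives faithfulness. -/
theorem isCommaObject_of {θ : d ≫ f ⟶ c ≫ g}
    (h₁ : ∀ {X : K} (x : X ⟶ B) (y : X ⟶ A) (φ : x ≫ f ⟶ y ≫ g),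
      ∃! h : X ⟶ P, h ≫ d = x ∧ h ≫ c = y ∧ h ◁ θ ≍ φ)
    (h₂ : ∀ {X : K} (h k : X ⟶ P) (α : h ≫ d ⟶ k ≫ d) (β : h ≫ c ⟶ k ≫ c),
      α ▷ f ≫ (α_ k d f).hom ≫ k ◁ θ ≫ (α_ k c g).inv =
        ((α_ h d f).hom ≫ h ◁ θ ≫ (α_ h c g).inv) ≫ β ▷ g →
      ∃! γ : h ⟶ k, γ ▷ d = α ∧ γ ▷ c = β) : IsCommaObject θ := by
  intro X
  refine { faithful := ⟨?_⟩, full := ⟨?_⟩, bijective_obj := ?_ }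
  · intro h k γ γ' e
    exact (h₂ h k (γ ▷ d) (γ ▷ c) ((commaComparison θ X).map γ).w).unique ⟨rfl, rfl⟩
      ⟨(congrArg CommaMorphism.left e).symm, (congrArg CommaMorphism.right e).symm⟩
  · intro h k m
    obtain ⟨γ, ⟨hd, hc⟩, -⟩ := h₂ h k m.left m.right m.w
    exact ⟨γ, by ext <;> assumption⟩
  · rw [Function.bijective_iff_existsUnique]
    intro y
    exact (existsUnique_congr fun h => commaComparison_obj_eq_iff θ h _).2
      (h₁ y.left y.right y.hom)

end

section

variable {A P : K} {d c : P ⟶ A} {θ : d ⟶ c}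

/-- A cotensor with the walking arrow classifies 2-cells. -/
theorem IsArrowCotensor.existsUnique_lift (hθ : IsArrowCotensor θ) {X : K}
    {x y : X ⟶ A} (φ : x ⟶ y) :
    ∃! h : X ⟶ P, h ≫ d = x ∧ h ≫ c = y ∧ h ◁ θ ≍ φ := by
  have := (hθ X).bijective_obj.existsUnique (Arrow.mk φ)
  refine (existsUnique_congr fun h => ?_).1 this
  rw [arrowComparison_obj, Arrow.mk_eq_mk_iff]
  constructor
  · rintro ⟨h₁, h₂, h₃⟩
    exact ⟨h₁, h₂, (heq_iff_eqToHom _ _ h₁ h₂).2 h₃⟩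
  · rintro ⟨h₁, h₂, h₃⟩
    exact ⟨h₁, h₂, (heq_iff_eqToHom _ _ h₁ h₂).1 h₃⟩

/-- The two-dimensional part of the universal property of a cotensor with the walking arrow. -/
theorem IsArrowCotensor.existsUnique_twoCell (hθ : IsArrowCotensor θ) {X : K}
    (h k : X ⟶ P) (α : h ≫ d ⟶ k ≫ d) (β : h ≫ c ⟶ k ≫ c)
    (w : α ≫ k ◁ θ = h ◁ θ ≫ β) :
    ∃! γ : h ⟶ k, γ ▷ d = α ∧ γ ▷ c = β := by
  have := hθ X
  let m : (arrowComparison θ X).obj h ⟶ (arrowComparison θ X).obj k := Arrow.homMk α β w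
  obtain ⟨γ, hγ⟩ := (arrowComparison θ X).map_surjective m
  refine ⟨γ, ⟨congrArg CommaMorphism.left hγ, congrArg CommaMorphism.right hγ⟩, ?_⟩
  rintro γ' ⟨h₁, h₂⟩
  apply (arrowComparison θ X).map_injective
  rw [hγ]
  ext
  exacts [h₁, h₂]

end

/-! ### Existence of comma objects -/

/-- A finitely complete 2-category has strict 2-pullbacks. -/
theorem FinitelyComplete.exists_twoPullback [FinitelyComplete K] {A B C : K} (f : A ⟶ C)
    (g : B ⟶ C) :
    ∃ (P : K) (fst : P ⟶ A) (snd : P ⟶ B), fst ≫ f = snd ≫ g ∧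
      (∀ {X : K} (a : X ⟶ A) (b : X ⟶ B), a ≫ f = b ≫ g →
        ∃! h : X ⟶ P, h ≫ fst = a ∧ h ≫ snd = b) ∧
      ∀ {X : K} (h k : X ⟶ P) (α : h ≫ fst ⟶ k ≫ fst) (β : h ≫ snd ⟶ k ≫ snd),
        α ▷ f ≍ β ▷ g → ∃! γ : h ⟶ k, γ ▷ fst = α ∧ γ ▷ snd = β := by
  obtain ⟨t, ⟨⟨ht⟩, ht₂⟩⟩ := FinitelyComplete.exists_conicalTwoLimit WalkingCospan (cospan f g)
  have hl : t.π.app .left ≫ f = t.π.app .one := t.w WalkingCospan.Hom.inl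
  have hr : t.π.app .right ≫ g = t.π.app .one := t.w WalkingCospan.Hom.inr
  refine ⟨t.pt, t.π.app .left, t.π.app .right, hl.trans hr.symm, ?_, ?_⟩
  · intro X a b w
    refine ⟨ht.lift (PullbackCone.mk a b w), ⟨ht.fac _ WalkingCospan.left,
      ht.fac _ WalkingCospan.right⟩, ?_⟩
    rintro h ⟨h₁, h₂⟩
    refine ht.hom_ext fun j => ?_
    refine Eq.trans ?_ (ht.fac (PullbackCone.mk a b w) j).symm
    rcases j with _ | _ | _
    · exact (congrArg (h ≫ ·) hl.symm).trans
        ((Category.assoc h _ f).symm.trans (congrArg (· ≫ f) h₁))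
    · exact h₁
    · exact h₂
  · intro X h k α β e
    have e₁ (l : X ⟶ t.pt) : (l ≫ t.π.app .left) ≫ f = l ≫ t.π.app .one :=
      (Category.assoc l _ f).trans (congrArg (l ≫ ·) hl)
    have e₂ (l : X ⟶ t.pt) : (l ≫ t.π.app .right) ≫ g = l ≫ t.π.app .one :=
      (Category.assoc l _ g).trans (congrArg (l ≫ ·) hr)
    -- The component at the vertex `.one` is forced by the left leg to be `α ▷ f`; the hypothesis
    -- `e` makes it agree with `β ▷ g` as well.
    let cells : ∀ j : WalkingCospan, h ≫ t.π.app j ⟶ k ≫ t.π.app j := fun j =>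
      match j with
      | .left => α
      | .right => β
      | .one => eqToHom (e₁ h).symm ≫ α ▷ f ≫ eqToHom (e₁ k)
    have hone : cells .one ≍ α ▷ f := eqToHom_comp_comp_eqToHom_heq ..
    obtain ⟨γ, hγ, hu⟩ := ht₂ h k cells (by
      intro i j s
      have hs (l : X ⟶ t.pt) : (l ≫ t.π.app i) ≫ (cospan f g).map s = l ≫ t.π.app j :=
        (Category.assoc l _ _).trans (congrArg (l ≫ ·) (t.w s))
      refine (heq_iff_eqToHom _ _ (hs h) (hs k)).1 ?_
      rcases s with _ | s
      · exact (whiskerRight_heq rfl rfl HEq.rfl ((cospan f g).map_id i)).trans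
          (whiskerRight_id_heq _)
      · cases s
        · exact hone.symm
        · exact e.symm.trans hone.symm)
    refine ⟨γ, ⟨hγ .left, hγ .right⟩, ?_⟩
    rintro γ' ⟨h₁, h₂⟩
    refine hu γ' fun j => ?_
    rcases j with _ | _ | _
    · apply eq_of_heq
      refine HEq.trans ?_ hone.symm
      rw [← h₁]
      exact (whiskerRight_heq rfl rfl HEq.rfl hl.symm).trans (whiskerRight_comp_heq ..)
    · exact h₁
    · exact h₂

theorem heq_eqToHom_iff {C₁ : Type*} [Category* C₁] {x y x' y' : C₁} (φ : x ⟶ y)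
    (hx : x = x') (hy : y = y') (h : x' = y') :
    φ ≍ eqToHom h ↔ φ = eqToHom (hx.trans (h.trans hy.symm)) := by
  subst hx hy h
  simp

theorem eqToHom_heq_eqToHom {C₁ : Type*} [Category* C₁] {x y x' y' : C₁} (h : x = y) (h' : x' = y')
    (hx : x = x') : eqToHom h ≍ eqToHom h' := by
  subst h h' hx
  rfl

/-- The comma object of `𝟙 B` and `f` is the pullback along `f` of the codomain projection of the
cotensor of `B` with the walking arrow. -/
theorem FinitelyComplete.exists_isCommaObject [FinitelyComplete K] {A B : K} (f : A ⟶ B) :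
    ∃ (P : K) (d : P ⟶ B) (c : P ⟶ A) (θ : d ≫ 𝟙 B ⟶ c ≫ f), IsCommaObject θ := by
  obtain ⟨T, d₀, c₀, θ₀, hθ₀⟩ := FinitelyComplete.exists_arrowCotensor B
  obtain ⟨P, p₁, p₂, w, hP₁, hP₂⟩ := FinitelyComplete.exists_twoPullback c₀ f
  let θ : (p₁ ≫ d₀) ≫ 𝟙 B ⟶ p₂ ≫ f :=
    eqToHom (Strict.comp_id (p₁ ≫ d₀)) ≫ p₁ ◁ θ₀ ≫ eqToHom w
  have hθ : θ ≍ p₁ ◁ θ₀ := eqToHom_comp_comp_eqToHom_heq ..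
  have whisker_heq {X : K} (h : X ⟶ P) : h ◁ θ ≍ (h ≫ p₁) ◁ θ₀ :=
    (whiskerLeft_heq (Strict.comp_id _) w.symm hθ rfl).trans (whiskerLeft_comp_heq ..).symm
  have comp_f {X : K} (h : X ⟶ P) : (h ≫ p₂) ≫ f = (h ≫ p₁) ≫ c₀ :=
    (Strict.assoc ..).trans ((congrArg (h ≫ ·) w.symm).trans (Strict.assoc ..).symm)
  refine ⟨P, p₁ ≫ d₀, p₂, θ, isCommaObject_of ?_ ?_⟩
  · intro X x y φ
    -- A square over `𝟙 B` and `f` is just a 2-cell `x ⟶ y ≫ f`. The cotensor classifies it by some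
    -- `a` with `a ≫ c₀ = y ≫ f`, so `a` and `y` together factor through the pullback.
    let φ' : x ⟶ y ≫ f := eqToHom (Strict.comp_id x).symm ≫ φ ≫ eqToHom rfl
    have hφ' : φ' ≍ φ := eqToHom_comp_comp_eqToHom_heq ..
    obtain ⟨a, ⟨ha₁, ha₂, ha₃⟩, ha⟩ := hθ₀.existsUnique_lift φ'
    obtain ⟨h, ⟨h₁, h₂⟩, hu⟩ := hP₁ a y ha₂
    refine ⟨h, ⟨?_, h₂, ?_⟩, ?_⟩
    · exact (Strict.assoc ..).symm.trans ((congrArg (· ≫ d₀) h₁).trans ha₁)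
    · refine (whisker_heq h).trans (HEq.trans ?_ hφ')
      exact (whiskerLeft_heq rfl rfl HEq.rfl h₁).trans ha₃
    · rintro h' ⟨h'₁, h'₂, h'₃⟩
      refine hu h' ⟨ha _ ⟨(Strict.assoc ..).trans h'₁, ?_, ?_⟩, h'₂⟩
      · exact (comp_f h').symm.trans (congrArg (· ≫ f) h'₂)
      · exact (whisker_heq h').symm.trans (h'₃.trans hφ'.symm)
  · intro X h k α β e
    let α' : (h ≫ p₁) ≫ d₀ ⟶ (k ≫ p₁) ≫ d₀ :=
      eqToHom (Strict.assoc ..) ≫ α ≫ eqToHom (Strict.assoc ..).symm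
    have hα' : α' ≍ α := eqToHom_comp_comp_eqToHom_heq ..
    -- Since `p₁ ≫ c₀ = p₂ ≫ f`, the codomain part of a 2-cell into the cotensor must be `β ▷ f`;
    -- the comma compatibility `e` then becomes compatibility with `θ₀`.
    let β' : (h ≫ p₁) ≫ c₀ ⟶ (k ≫ p₁) ≫ c₀ :=
      eqToHom (comp_f h).symm ≫ β ▷ f ≫ eqToHom (comp_f k)
    have hβ' : β' ≍ β ▷ f := eqToHom_comp_comp_eqToHom_heq ..
    have dom (l : X ⟶ P) : (l ≫ p₁) ≫ d₀ = (l ≫ p₁ ≫ d₀) ≫ 𝟙 B :=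
      (Strict.assoc ..).trans (Strict.comp_id _).symm
    obtain ⟨γ₁, ⟨h₁, h₂⟩, hu₁⟩ := hθ₀.existsUnique_twoCell (h ≫ p₁) (k ≫ p₁) α' β' (by
      apply eq_of_heq
      refine HEq.trans ?_ ((heq_of_eq e).trans ?_)
      · refine comp_heq_comp (dom h) (dom k) (comp_f k).symm
          (hα'.trans (whiskerRight_id_heq α).symm) ?_
        exact (whisker_heq k).symm.trans (commaComparison_obj_hom_heq θ k).symm
      · refine comp_heq_comp (dom h).symm (comp_f h) (comp_f k) ?_ hβ'.symm
        exact (commaComparison_obj_hom_heq θ h).trans (whisker_heq h))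
    obtain ⟨γ, ⟨hγ₁, hγ₂⟩, hu⟩ := hP₂ h k γ₁ β (by rw [h₂]; exact hβ')
    refine ⟨γ, ⟨eq_of_heq ?_, hγ₂⟩, ?_⟩
    · exact (whiskerRight_comp_heq ..).trans (by rw [hγ₁, h₁]; exact hα')
    · rintro γ' ⟨h'₁, h'₂⟩
      refine hu γ' ⟨hu₁ _ ⟨eq_of_heq ?_, eq_of_heq ?_⟩, h'₂⟩
      · exact (whiskerRight_comp_heq ..).symm.trans ((heq_of_eq h'₁).trans hα'.symm)
      · refine (whiskerRight_comp_heq ..).symm.trans (HEq.trans ?_ hβ'.symm)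
        rw [← h'₂]
        exact (whiskerRight_heq rfl rfl HEq.rfl w).trans (whiskerRight_comp_heq ..)

/-! ### The 1-cell induced by the identity, and its adjunction unit -/

section Induced

variable {A B P : K} {f : A ⟶ B} {d : P ⟶ B} {c : P ⟶ A} {θ : d ≫ 𝟙 B ⟶ c ≫ f}

/-- Puts the condition in the form of a lift of the identity square on `f`, to which the universal
property of the comma object applies directly. -/
theorem inducedByIdentity_iff (i : A ⟶ P) :
    InducedByIdentity θ i ↔ i ≫ d = f ∧ i ≫ c = 𝟙 A ∧ i ◁ θ ≍
      eqToHom ((Strict.comp_id f).trans (Strict.id_comp f).symm) := by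
  have hdom (h : i ≫ d = f) : i ≫ d ≫ 𝟙 B = f ≫ 𝟙 B :=
    (Strict.assoc ..).symm.trans (congrArg (· ≫ 𝟙 B) h)
  have hcod (h : i ≫ c = 𝟙 A) : i ≫ c ≫ f = 𝟙 A ≫ f :=
    (Strict.assoc ..).symm.trans (congrArg (· ≫ f) h)
  constructor
  · rintro ⟨hc, hd, h⟩
    exact ⟨hd, hc, (heq_eqToHom_iff _ (hdom hd) (hcod hc) _).2 h⟩
  · rintro ⟨hd, hc, h⟩
    exact ⟨hc, hd, (heq_eqToHom_iff _ (hdom hd) (hcod hc) _).1 h⟩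

theorem IsCommaObject.existsUnique_inducedByIdentity (hθ : IsCommaObject θ) :
    ∃! i : A ⟶ P, InducedByIdentity θ i :=
  (existsUnique_congr fun i => inducedByIdentity_iff i).2
    (hθ.existsUnique_lift f (𝟙 A) (eqToHom ((Strict.comp_id f).trans (Strict.id_comp f).symm)))

/-- The unit of the adjunction between the codomain projection of a comma object `B/f` and the
1-cell induced by the identity of `f`. -/
theorem IsCommaObject.exists_unit (hθ : IsCommaObject θ) {i : A ⟶ P}
    (hi : InducedByIdentity θ i) :
    ∃ η : 𝟙 P ⟶ c ≫ i, η ▷ d ≍ θ ∧ η ▷ c ≍ 𝟙 c := by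
  have hd : c ≫ f = (c ≫ i) ≫ d :=
    (congrArg (c ≫ ·) hi.comp_right.symm).trans (Strict.assoc ..).symm
  have hc : c = (c ≫ i) ≫ c :=
    (Strict.comp_id c).symm.trans
      ((congrArg (c ≫ ·) hi.comp_left.symm).trans (Strict.assoc ..).symm)
  have hd' : d ≫ 𝟙 B = 𝟙 P ≫ d := (Strict.comp_id d).trans (Strict.id_comp d).symm
  -- The components of `η` are `θ` and an identity, up to transport.
  let α : 𝟙 P ≫ d ⟶ (c ≫ i) ≫ d := eqToHom hd'.symm ≫ θ ≫ eqToHom hd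
  have hα : α ≍ θ := eqToHom_comp_comp_eqToHom_heq ..
  let β : 𝟙 P ≫ c ⟶ (c ≫ i) ≫ c := eqToHom ((Strict.id_comp c).trans hc)
  have hβ : β ≍ 𝟙 c := eqToHom_heq_eqToHom _ rfl (Strict.id_comp c)
  obtain ⟨η, h₁, h₂⟩ := hθ.exists_twoCell (𝟙 P) (c ≫ i) α β (by
    have e₁ : (c ≫ i) ◁ θ ≍ 𝟙 (c ≫ f) := by
      refine (whiskerLeft_comp_heq ..).trans ?_
      rw [hi.whiskerLeft_eq, whiskerLeft_eqToHom]
      exact eqToHom_heq_eqToHom _ rfl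
        ((Strict.assoc ..).symm.trans ((Strict.assoc ..).symm.trans
          ((Strict.comp_id _).trans hd.symm)))
    have e₂ : β ▷ f ≍ 𝟙 (c ≫ f) := by
      rw [eqToHom_whiskerRight]
      exact eqToHom_heq_eqToHom _ rfl (congrArg (· ≫ f) (Strict.id_comp c))
    have hcf : ((c ≫ i) ≫ c) ≫ f = c ≫ f := congrArg (· ≫ f) hc.symm
    apply eq_of_heq
    -- Both sides of the compatibility square reduce to `θ` followed by an identity: on one side
    -- because `i ◁ θ` is an identity, on the other because `β` is.
    refine HEq.trans (b := θ ≫ 𝟙 (c ≫ f)) ?_ (HEq.trans (b := θ ≫ 𝟙 (c ≫ f)) HEq.rfl ?_)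
    · refine comp_heq_comp ((Strict.comp_id _).trans hd'.symm) ((Strict.comp_id _).trans hd.symm)
        hcf ((whiskerRight_id_heq α).trans hα) ?_
      exact (commaComparison_obj_hom_heq θ _).trans e₁
    · refine comp_heq_comp (hd'.trans (Strict.comp_id _).symm)
        (congrArg (· ≫ f) (Strict.id_comp c).symm) hcf.symm ?_ e₂.symm
      exact ((commaComparison_obj_hom_heq θ _).trans (id_whiskerLeft_heq θ)).symm)
  exact ⟨η, by rw [h₁]; exact hα, by rw [h₂]; exact hβ⟩

end Induced

/-! ### Cartesian lifts and the Yoneda bijection -/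

section Fibration

variable {A B : K} {E : TwoSpan A B}

/-- Existence of cartesian lifts of 2-cells along the right leg of a two-sided discrete
fibration. -/
theorem TwoSpan.IsTwoSidedDiscreteFibration.exists_cartesian_lift
    (hE : E.IsTwoSidedDiscreteFibration) {X : K} (e : X ⟶ E.apex) {b : X ⟶ B} (φ : b ⟶ e ≫ E.r) :
    ∃ (e' : X ⟶ E.apex) (ζ : e' ⟶ e), e' ≫ E.r = b ∧ e' ≫ E.l = e ≫ E.l ∧ ζ ▷ E.r ≍ φ ∧
      ζ ▷ E.l ≍ 𝟙 (e ≫ E.l) := by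
  obtain ⟨⟨e', ζ⟩, ⟨h₁, h₂⟩, -⟩ := (hE X).existsUnique_cartesian_lift e φ
  replace h₁ := (isHomLift_iff_heq ..).1 h₁
  replace h₂ := (isHomLift_iff_heq ..).1 h₂
  exact ⟨e', ζ, h₁.1, h₂.1, h₁.2.2, h₂.2.2⟩

/-- Uniqueness of domains of cartesian lifts along the right leg of a two-sided discrete
fibration. -/
theorem TwoSpan.IsTwoSidedDiscreteFibration.eq_of_cartesian_lifts
    (hE : E.IsTwoSidedDiscreteFibration) {X : K} {e e₁ e₂ : X ⟶ E.apex} (ζ₁ : e₁ ⟶ e)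
    (ζ₂ : e₂ ⟶ e) (hl₁ : e₁ ≫ E.l = e ≫ E.l) (hl₂ : e₂ ≫ E.l = e ≫ E.l)
    (hr : e₁ ≫ E.r = e₂ ≫ E.r) (hζ₁ : ζ₁ ▷ E.l ≍ 𝟙 (e ≫ E.l)) (hζ₂ : ζ₂ ▷ E.l ≍ 𝟙 (e ≫ E.l))
    (hζ : ζ₁ ▷ E.r ≍ ζ₂ ▷ E.r) : e₁ = e₂ := by
  have := ((hE X).existsUnique_cartesian_lift e (ζ₂ ▷ E.r)).unique
    (y₁ := ⟨e₁, ζ₁⟩) (y₂ := ⟨e₂, ζ₂⟩)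
    ⟨(isHomLift_iff_heq ..).2 ⟨hr, rfl, hζ⟩, (isHomLift_iff_heq ..).2 ⟨hl₁, rfl, hζ₁⟩⟩
    ⟨(isHomLift_iff_heq ..).2 ⟨rfl, rfl, HEq.rfl⟩, (isHomLift_iff_heq ..).2 ⟨hl₂, rfl, hζ₂⟩⟩
  exact congrArg Sigma.fst this

variable {P : K} {f : A ⟶ B} {d : P ⟶ B} {c : P ⟶ A} {θ : d ≫ 𝟙 B ⟶ c ≫ f}

/-- The 2-cell is `η` whiskered with `k`. As `k` commutes with the legs, whiskering further with
`E.l` and `E.r` gives `η ▷ c` and `η ▷ d`. -/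
theorem IsCommaObject.exists_cartesian_of_spanHom (hθ : IsCommaObject θ) {i : A ⟶ P}
    (hi : InducedByIdentity θ i) (k : TwoSpan.mk c d ⟶ E) {g : A ⟶ E.apex} (hg : i ≫ k.hom = g) :
    ∃ ζ : k.hom ⟶ c ≫ g, ζ ▷ E.l ≍ 𝟙 c ∧ ζ ▷ E.r ≍ θ := by
  obtain ⟨η, hd, hc⟩ := hθ.exists_unit hi
  have hl : k.hom ≫ E.l = c := k.hom_l
  have hr : k.hom ≫ E.r = d := k.hom_r
  generalize k.hom = m at *
  have hm : (c ≫ i) ≫ m = c ≫ g := (Strict.assoc ..).trans (congrArg (c ≫ ·) hg)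
  let ζ : m ⟶ c ≫ g := eqToHom (Strict.id_comp m).symm ≫ η ▷ m ≫ eqToHom hm
  have hζ : ζ ≍ η ▷ m := eqToHom_comp_comp_eqToHom_heq ..
  have whisker_heq {Y : K} (l : E.apex ⟶ Y) {s : P ⟶ Y} (hs : m ≫ l = s) :
      ζ ▷ l ≍ η ▷ s :=
    (whiskerRight_heq (Strict.id_comp m).symm hm.symm hζ rfl).trans
      ((whiskerRight_comp_heq ..).symm.trans (whiskerRight_heq rfl rfl HEq.rfl hs))
  exact ⟨ζ, (whisker_heq E.l hl).trans hc, (whisker_heq E.r hr).trans hd⟩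

theorem IsCommaObject.bijective_spanHom_comp (hθ : IsCommaObject θ)
    (hE : E.IsTwoSidedDiscreteFibration) {i : A ⟶ P} (hi : InducedByIdentity θ i) :
    Function.Bijective (fun k : TwoSpan.mk c d ⟶ E => hi.spanHom ≫ k) := by
  constructor
  · intro k k' h
    have hg : i ≫ k.hom = i ≫ k'.hom := congrArg Span.Hom.hom h
    -- By `hg`, both 2-cells can be given the codomain `c ≫ i ≫ k'.hom`. They are then lifts of the
    -- same `θ`, so their domains `k.hom` and `k'.hom` coincide.
    obtain ⟨ζ, hζl, hζr⟩ := hθ.exists_cartesian_of_spanHom hi k hg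
    obtain ⟨ζ', hζ'l, hζ'r⟩ := hθ.exists_cartesian_of_spanHom hi k' rfl
    have hl : k.hom ≫ E.l = c := k.hom_l
    have hr : k.hom ≫ E.r = d := k.hom_r
    have hl' : k'.hom ≫ E.l = c := k'.hom_l
    have hr' : k'.hom ≫ E.r = d := k'.hom_r
    have he : (c ≫ i ≫ k'.hom) ≫ E.l = c := by
      refine (Strict.assoc ..).trans ((congrArg (c ≫ ·) ?_).trans (Strict.comp_id c))
      exact (Strict.assoc ..).trans ((congrArg (i ≫ ·) hl').trans hi.comp_left)
    have hid : 𝟙 c ≍ 𝟙 ((c ≫ i ≫ k'.hom) ≫ E.l) := by rw [he]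
    exact Span.hom_ext (hE.eq_of_cartesian_lifts ζ ζ' (hl.trans he.symm) (hl'.trans he.symm)
      (hr.trans hr'.symm) (hζl.trans hid) (hζ'l.trans hid) (hζr.trans hζ'r.symm))
  · intro m
    have hml : m.hom ≫ E.l = 𝟙 A := m.hom_l
    have hmr : m.hom ≫ E.r = f := m.hom_r
    -- Renaming gives the 1-cell source `A` itself in place of the apex of a span.
    obtain ⟨g, hg⟩ : ∃ g : A ⟶ E.apex, m.hom = g := ⟨_, rfl⟩
    rw [hg] at hml hmr
    have hcl : (c ≫ g) ≫ E.l = c :=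
      (Strict.assoc ..).trans ((congrArg (c ≫ ·) hml).trans (Strict.comp_id c))
    have hcr : c ≫ f = (c ≫ g) ≫ E.r :=
      (congrArg (c ≫ ·) hmr.symm).trans (Strict.assoc ..).symm
    obtain ⟨k, ζ, hr, hl, hζr, hζl⟩ := hE.exists_cartesian_lift (c ≫ g)
      (eqToHom (Strict.comp_id d).symm ≫ θ ≫ eqToHom hcr)
    replace hζr : ζ ▷ E.r ≍ θ := hζr.trans (eqToHom_comp_comp_eqToHom_heq ..)
    have hig : i ≫ c ≫ g = g :=
      (Strict.assoc ..).symm.trans ((congrArg (· ≫ g) hi.comp_left).trans (Strict.id_comp g))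
    have key : i ≫ k = i ≫ c ≫ g := by
      have hil : (i ≫ k) ≫ E.l = (i ≫ c ≫ g) ≫ E.l :=
        (Strict.assoc ..).trans ((congrArg (i ≫ ·) hl).trans (Strict.assoc ..).symm)
      have hir : (i ≫ k) ≫ E.r = (i ≫ c ≫ g) ≫ E.r := by
        refine (Strict.assoc ..).trans ((congrArg (i ≫ ·) hr).trans (hi.comp_right.trans ?_))
        exact hmr.symm.trans (congrArg (· ≫ E.r) hig.symm)
      -- Since `i ◁ θ` and `i ≫ c` are identities, `i ◁ ζ` and the identity of `i ≫ c ≫ g` both lift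
      -- an identity 2-cell with the same codomain, so their domains agree.
      refine hE.eq_of_cartesian_lifts (i ◁ ζ) (𝟙 (i ≫ c ≫ g)) hil rfl hir ?_ ?_ ?_
      · refine (whisker_assoc_heq ..).trans
          ((whiskerLeft_heq hl rfl hζl rfl).trans ?_)
        rw [whiskerLeft_id]
        exact eqToHom_heq_eqToHom rfl rfl (Strict.assoc i (c ≫ g) E.l).symm
      · rw [id_whiskerRight]
      · refine (whisker_assoc_heq ..).trans
          ((whiskerLeft_heq (hr.trans (Strict.comp_id d).symm) hcr.symm hζr rfl).trans ?_)
        rw [hi.whiskerLeft_eq, id_whiskerRight]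
        refine eqToHom_heq_eqToHom (x' := (i ≫ c ≫ g) ≫ E.r) _ rfl ?_
        exact (Strict.assoc ..).symm.trans ((Strict.comp_id _).trans
          ((congrArg (i ≫ ·) hr.symm).trans ((Strict.assoc ..).symm.trans hir)))
    refine ⟨Span.Hom.mk k (hl.trans hcl) hr, Span.hom_ext ?_⟩
    exact (key.trans hig).trans hg.symm

end Fibration

end TwoCat

theorem mainTheorem8 {K : Type u} [Bicategory.{w, v} K] [Bicategory.Strict K]
    [TwoCat.FinitelyComplete K] {A B : K} (f : A ⟶ B)
    (E : TwoCat.TwoSpan A B) (hE : E.IsTwoSidedDiscreteFibration) :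
    (∃ (P : K) (d : P ⟶ B) (c : P ⟶ A) (θ : d ≫ 𝟙 B ⟶ c ≫ f), TwoCat.IsCommaObject θ) ∧
    ∀ (P : K) (d : P ⟶ B) (c : P ⟶ A) (θ : d ≫ 𝟙 B ⟶ c ≫ f), TwoCat.IsCommaObject θ →
      (∃! i : A ⟶ P, TwoCat.InducedByIdentity θ i) ∧
      ∀ (i : A ⟶ P) (hi : TwoCat.InducedByIdentity θ i),
        Function.Bijective (fun k : TwoCat.TwoSpan.mk c d ⟶ E => hi.spanHom ≫ k) :=
  ⟨TwoCat.FinitelyComplete.exists_isCommaObject f, fun _ _ _ _ hθ =>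
    ⟨hθ.existsUnique_inducedByIdentity, fun _ hi => hθ.bijective_spanHom_comp hE hi⟩⟩
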